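/- Let $\Delta$ be a simplicial complex on a finite vertex set $V(\Delta)$ (with $\Delta\neq\{\emptyset\}$), let $\mathbb K$ be a field, $R=\mathbb K[x_v\mid v\in V(\Delta)]$, and let $I(\Delta)=\langle \prod_{v\in F}x_v \mid F \text{ a facet of }\Delta\rangle$ be the facet ideal of $\Delta$. A facet $F$ of a complex is a leaf if it is the only facet or there is a facet $G\ne F$ with $F\cap H\subseteq F\cap G$ for all facets $H\neq F$. A subcomplex of $\Delta$ is a simplicial complex all of whose facets are facets of $\Delta$; $\Delta$ is a simplicial forest if every connected component of $\Delta$ is a simplicial tree, that is, a connected complex each of whose nonempty subcomplexes has a leaf. The matching number $\nu(\Delta)$ is the maximal number of pairwise disjoint facets of $\Delta$. The square-free power $I(\Delta)^{[k]}$ is the ideal of $R$ generated by the square-free monomials contained in $I(\Delta)^k$. Theorem 3.5. Suppose that $\Delta$ is a Cohen–Macaulay simplicial forest, that is, $\Delta$ is a simplicial forest and the ring $R/I(\Delta)$ is Cohen–Macaulay. Then for every integer $k$ with $1\le k\le\nu(\Delta)$, $$\dim\bigl(R/I(\Delta)^{[k]}\bigr)=|V(\Delta)|-\nu(\Delta)+k-1,$$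 and the height of $I(\Delta)^{[k]}$ is $\nu(\Delta)-k+1$. -/

import Mathlib

noncomputable section

/-! ### Cohen–Macaulay rings -/

/-- The depth of a local ring: the supremum of the lengths of the regular sequences
in its maximal ideal. -/
def localRingDepth (A : Type*) [CommRing A] [IsLocalRing A] : ℕ∞ :=
  ⨆ (rs : List A) (_ : (∀ r ∈ rs, r ∈ IsLocalRing.maximalIdeal A) ∧
    RingTheory.Sequence.IsRegular A rs), (rs.length : ℕ∞)

/-- A Noetherian local ring is Cohen–Macaulay if its depth equals its Krull dimension. -/
def IsCohenMacaulayLocalRing (A : Type*) [CommRing A] [IsLocalRing A] : Prop :=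
  IsNoetherianRing A ∧ (localRingDepth A : WithBot ℕ∞) = ringKrullDim A

/-- A Noetherian ring is Cohen–Macaulay if its localization at every maximal ideal is a
Cohen–Macaulay local ring. -/
def IsCohenMacaulayRing (A : Type*) [CommRing A] : Prop :=
  IsNoetherianRing A ∧
    ∀ (m : Ideal A) [m.IsMaximal], IsCohenMacaulayLocalRing (Localization.AtPrime m)

/-! ### Simplicial complexes, forests, matchings

A simplicial complex on the vertex set `V` is a `PreAbstractSimplicialComplex V`; in Mathlib the
faces are taken to be nonempty, and a vertex `v` need not satisfy `{v} ∈ Δ`. -/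

namespace PreAbstractSimplicialComplex

variable {V : Type*}

/-- The facets are the inclusion-maximal faces. -/
def facets (Δ : PreAbstractSimplicialComplex V) : Set (Finset V) :=
  {F | Maximal (· ∈ Δ.faces) F}

/-- `Γ` is a subcomplex of `Δ` in the sense of facet ideal theory: every facet of `Γ` is a facet
of `Δ`. -/
def IsSubcomplex (Γ Δ : PreAbstractSimplicialComplex V) : Prop :=
  Γ.facets ⊆ Δ.facets

/-- A facet `F` is a leaf if it is the only facet, or if there is another facet `G` (a joint) such
that `F ∩ H ⊆ F ∩ G` for all facets `H ≠ F`. -/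
def IsLeaf (Δ : PreAbstractSimplicialComplex V) (F : Finset V) : Prop :=
  F ∈ Δ.facets ∧
    (Δ.facets = {F} ∨
      ∃ G ∈ Δ.facets, G ≠ F ∧ ∀ H ∈ Δ.facets, H ≠ F → (F ∩ H : Set V) ⊆ F ∩ G)

/-- Two facets are linked if they are joined by a chain of facets in which consecutive members
intersect. -/
def Linked (Δ : PreAbstractSimplicialComplex V) : Finset V → Finset V → Prop :=
  Relation.ReflTransGen fun F G ↦ F ∈ Δ.facets ∧ G ∈ Δ.facets ∧ ¬ Disjoint F G

/-- A complex is connected if any two of its facets are linked. -/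
def IsConnected (Δ : PreAbstractSimplicialComplex V) : Prop :=
  ∀ F ∈ Δ.facets, ∀ G ∈ Δ.facets, Δ.Linked F G

/-- `Γ` is a connected component of `Δ`: its facets are all the facets of `Δ` linked to
some given facet of `Δ`. -/
def IsConnectedComponent (Γ Δ : PreAbstractSimplicialComplex V) : Prop :=
  ∃ F ∈ Δ.facets, Γ.facets = {G | G ∈ Δ.facets ∧ Δ.Linked F G}

/-- A simplicial tree: a connected complex all of whose nonempty subcomplexes have a leaf. -/
def IsSimplicialTree (Δ : PreAbstractSimplicialComplex V) : Prop :=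
  Δ.IsConnected ∧
    ∀ Γ : PreAbstractSimplicialComplex V, Γ.IsSubcomplex Δ → Γ.facets.Nonempty →
      ∃ F, Γ.IsLeaf F

/-- A simplicial forest: a complex all of whose connected components are simplicial trees. -/
def IsSimplicialForest (Δ : PreAbstractSimplicialComplex V) : Prop :=
  ∀ Γ : PreAbstractSimplicialComplex V, Γ.IsConnectedComponent Δ → Γ.IsSimplicialTree

/-- A matching is a set of pairwise disjoint facets. -/
def IsMatching (Δ : PreAbstractSimplicialComplex V) (M : Finset (Finset V)) : Prop :=
  (M : Set (Finset V)) ⊆ Δ.facets ∧ (M : Set (Finset V)).PairwiseDisjoint id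

/-- The matching number `ν(Δ)`: the largest cardinality of a matching. -/
def matchingNumber (Δ : PreAbstractSimplicialComplex V) : ℕ :=
  sSup {n | ∃ M : Finset (Finset V), Δ.IsMatching M ∧ M.card = n}

/-- The facet ideal `I(Δ)` of `K[V]`, generated by the monomials `∏_{v ∈ F} x_v` for the
facets `F` of `Δ`. -/
def facetIdeal (Δ : PreAbstractSimplicialComplex V) (K : Type*) [Field K] :
    Ideal (MvPolynomial V K) :=
  Ideal.span {f | ∃ F ∈ Δ.facets, f = ∏ v ∈ F, MvPolynomial.X v}

/-- A Cohen–Macaulay simplicial forest over the field `K`: a simplicial forest `Δ` such that the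
ring `K[V] / I(Δ)` is Cohen–Macaulay. -/
def IsCohenMacaulayForest (Δ : PreAbstractSimplicialComplex V) (K : Type*) [Field K] : Prop :=
  Δ.IsSimplicialForest ∧ IsCohenMacaulayRing (MvPolynomial V K ⧸ Δ.facetIdeal K)

end PreAbstractSimplicialComplex

/-- The `k`-th square-free power `I^{[k]}`: the ideal generated by the square-free monomials
`∏_{v ∈ S} x_v` contained in `I ^ k`. -/
def squareFreePower {V K : Type*} [Field K] (I : Ideal (MvPolynomial V K)) (k : ℕ) :
    Ideal (MvPolynomial V K) :=
  Ideal.span {f | f ∈ I ^ k ∧ ∃ S : Finset V, f = ∏ v ∈ S, MvPolynomial.X v}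

end

/-! The forest structure gives the Kőnig property: some vertex cover `C` has at most `ν(Δ)`
elements. A square-free monomial in `I(Δ)^k` is divisible by at least `k` variables of `C`, so after
deleting `k - 1` vertices from `C` the remaining variables still generate a prime containing
`I(Δ)^{[k]}`. This bounds the height above by `ν(Δ) - k + 1` and the dimension below by the
complementary number. Conversely, let a prime `P` contain `I(Δ)^{[k]}` and take a maximum matching.
If `k` of its facets contained no variable of `P`, their product would be a generator of
`I(Δ)^{[k]}` outside `P`. So at least `ν(Δ) - k + 1` disjoint facets each contribute a variable to
`P`, which bounds the height below. The inequality `dim R/J + ht J ≤ dim R` gives the dimension. -/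

/-- **Kőnig property.** If every nonempty subfamily of a finite family of nonempty finite sets has
a leaf, then the family has a matching and a transversal such that the transversal is at most as
large as the matching. -/
theorem exists_matching_transversal_of_leaf {ι V : Type*} [DecidableEq ι] [DecidableEq V]
    (s : Finset ι) (f : ι → Finset V) (hne : ∀ i ∈ s, (f i).Nonempty)
    (hleaf : ∀ t ⊆ s, t.Nonempty → ∃ i ∈ t, t = {i} ∨
      ∃ j ∈ t, j ≠ i ∧ ∀ h ∈ t, h ≠ i → f i ∩ f h ⊆ f i ∩ f j) :
    ∃ m ⊆ s, (m : Set ι).PairwiseDisjoint f ∧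
      ∃ C : Finset V, C.card ≤ m.card ∧ ∀ i ∈ s, (f i ∩ C).Nonempty := by
  induction s using Finset.strongInduction generalizing f with
  | H s ih =>
  rcases s.eq_empty_or_nonempty with rfl | hs
  · exact ⟨∅, by simp, by simp, ∅, by simp, by simp⟩
  obtain ⟨i, hi, hcase⟩ := hleaf s subset_rfl hs
  by_cases hdisj : ∀ h ∈ s, h ≠ i → Disjoint (f i) (f h)
  · obtain ⟨m, hm, hmd, C, hC, hCs⟩ := ih (s.erase i) (Finset.erase_ssubset hi) f
      (fun j hj ↦ hne j (Finset.mem_of_mem_erase hj))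
      (fun t ht ↦ hleaf t (ht.trans (Finset.erase_subset _ _)))
    have him : i ∉ m := fun h ↦ Finset.notMem_erase i s (hm h)
    obtain ⟨v, hv⟩ := hne i hi
    refine ⟨insert i m, Finset.insert_subset hi (hm.trans (Finset.erase_subset _ _)), ?_,
      insert v C, ?_, ?_⟩
    · rw [Finset.coe_insert]
      refine hmd.insert fun j hj hij ↦ hdisj j (Finset.mem_of_mem_erase (hm hj)) hij.symm
    · rw [Finset.card_insert_of_notMem him]
      exact (Finset.card_insert_le _ _).trans (by lia)
    · intro j hj
      by_cases hji : j = i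
      · subst hji
        exact ⟨v, by simp [hv]⟩
      · obtain ⟨w, hw⟩ := hCs j (Finset.mem_erase.2 ⟨hji, hj⟩)
        rw [Finset.mem_inter] at hw
        exact ⟨w, by simp [hw.1, hw.2]⟩
  · push Not at hdisj
    obtain ⟨h₀, hh₀, hh₀i, hnd⟩ := hdisj
    obtain rfl | ⟨j, hj, hji, hjoint⟩ := hcase
    · exact absurd (Finset.mem_singleton.1 hh₀) hh₀i
    -- Shrinking the leaf to its trace on the joint makes the joint superfluous.
    set g : ι → Finset V := Function.update f i (f i ∩ f j) with hg
    have hgi : g i = f i ∩ f j := by simp [hg]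
    have hgn : ∀ h, h ≠ i → g h = f h := fun h hh ↦ by simp [hg, hh]
    have hinter : ∀ h ∈ s, h ≠ i → f i ∩ f j ∩ f h = f i ∩ f h := fun h hh hhi ↦ by
      have := hjoint h hh hhi
      grind
    -- Leaves and disjointness depend only on pairwise intersections, so both pass between `f` and
    -- `g`.
    have hgg : ∀ a ∈ s, ∀ b ∈ s, a ≠ b → g a ∩ g b = f a ∩ f b := fun a ha b hb hab ↦ by
      by_cases hai : a = i
      · subst hai
        rw [hgi, hgn b hab.symm, hinter b hb hab.symm]
      · by_cases hbi : b = i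
        · subst hbi
          rw [hgi, hgn a hai, Finset.inter_comm, hinter a ha hai, Finset.inter_comm]
        · rw [hgn a hai, hgn b hbi]
    have hjg : (f i ∩ f j).Nonempty := by
      obtain ⟨v, hv⟩ := Finset.not_disjoint_iff_nonempty_inter.1 hnd
      exact ⟨v, hjoint h₀ hh₀ hh₀i hv⟩
    obtain ⟨m, hm, hmd, C, hC, hCs⟩ := ih (s.erase j) (Finset.erase_ssubset hj) g
      (fun h hh ↦ by
        by_cases hhi : h = i
        · rw [hhi, hgi]; exact hjg
        · rw [hgn h hhi]; exact hne h (Finset.mem_of_mem_erase hh))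
      (fun t ht htn ↦ by
        have hts : t ⊆ s := ht.trans (Finset.erase_subset _ _)
        obtain ⟨a, ha, hta | ⟨b, hb, hba, hab⟩⟩ := hleaf t hts htn
        · exact ⟨a, ha, .inl hta⟩
        · refine ⟨a, ha, .inr ⟨b, hb, hba, fun h hh hha ↦ ?_⟩⟩
          rw [hgg a (hts ha) h (hts hh) hha.symm, hgg a (hts ha) b (hts hb) hba.symm]
          exact hab h hh hha)
    have hms : m ⊆ s := hm.trans (Finset.erase_subset _ _)
    -- A point of `C` in the shrunken leaf lies in `f j` as well, so the discarded joint is covered.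
    have hiC : (f i ∩ f j ∩ C).Nonempty := by
      simpa [hgi] using hCs i (Finset.mem_erase.2 ⟨hji.symm, hi⟩)
    refine ⟨m, hms, fun a ha b hb hab ↦ ?_, C, hC, fun h hh ↦ ?_⟩
    · have := hmd ha hb hab
      simp only [Function.onFun, Finset.disjoint_iff_inter_eq_empty] at this ⊢
      rwa [hgg a (hms ha) b (hms hb) hab] at this
    · by_cases hhi : h = i
      · subst hhi
        exact hiC.mono (by grind)
      · by_cases hhj : h = j
        · subst hhj
          exact hiC.mono (by grind)
        · simpa [hgn h hhi] using hCs h (Finset.mem_erase.2 ⟨hhj, hh⟩)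

/-! ### Leaves and vertex covers of simplicial forests -/

namespace PreAbstractSimplicialComplex

variable {V : Type*}

theorem nonempty_of_mem_facets {Δ : PreAbstractSimplicialComplex V} {F : Finset V}
    (hF : F ∈ Δ.facets) : F.Nonempty :=
  (Δ.isRelLowerSet_faces hF.prop).1

theorem eq_of_mem_facets_of_subset {Δ : PreAbstractSimplicialComplex V} {F G : Finset V}
    (hF : F ∈ Δ.facets) (hG : G ∈ Δ.facets) (h : F ⊆ G) : F = G :=
  hF.eq_of_le hG.prop h

/-- Every set of facets of a complex is the set of facets of a subcomplex. -/
theorem exists_facets_eq {Δ : PreAbstractSimplicialComplex V} {A : Set (Finset V)}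
    (hA : A ⊆ Δ.facets) : ∃ Γ : PreAbstractSimplicialComplex V, Γ.facets = A := by
  refine ⟨⟨{s | s.Nonempty ∧ ∃ a ∈ A, s ⊆ a}, fun s hs ↦ ⟨hs.1, fun t hts ht ↦
    ⟨ht, hs.2.imp fun a ha ↦ ⟨ha.1, subset_trans hts ha.2⟩⟩⟩⟩, ?_⟩
  ext F
  constructor
  · rintro ⟨⟨-, a, ha, hFa⟩, hmax⟩
    have : a = F := subset_antisymm
      (hmax ⟨nonempty_of_mem_facets (hA ha), a, ha, subset_rfl⟩ hFa) hFa
    exact this ▸ ha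
  · intro hF
    refine ⟨⟨nonempty_of_mem_facets (hA hF), F, hF, subset_rfl⟩, ?_⟩
    rintro G ⟨-, a, ha, hGa⟩ hFG
    rw [eq_of_mem_facets_of_subset (hA hF) (hA ha) (subset_trans hFG hGa)]
    exact hGa

/-- Every nonempty set of facets of a simplicial forest has a leaf. -/
theorem IsSimplicialForest.exists_leaf [DecidableEq V] {Δ : PreAbstractSimplicialComplex V}
    (hΔ : Δ.IsSimplicialForest) (t : Finset (Finset V)) (ht : (t : Set (Finset V)) ⊆ Δ.facets)
    (htn : t.Nonempty) :
    ∃ F ∈ t, t = {F} ∨ ∃ G ∈ t, G ≠ F ∧ ∀ H ∈ t, H ≠ F → F ∩ H ⊆ F ∩ G := by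
  obtain ⟨F₀, hF₀⟩ := htn
  obtain ⟨Γ, hΓ⟩ := exists_facets_eq (Δ := Δ) (A := {G | G ∈ Δ.facets ∧ Δ.Linked F₀ G})
    fun _ h ↦ h.1
  have htree := hΔ Γ ⟨F₀, ht hF₀, hΓ⟩
  obtain ⟨Λ, hΛ⟩ := exists_facets_eq (Δ := Γ) (A := {G | G ∈ t ∧ Δ.Linked F₀ G})
    fun G h ↦ hΓ ▸ ⟨ht h.1, h.2⟩
  obtain ⟨F, hF, hleaf⟩ := htree.2 Λ (by
    rw [IsSubcomplex, hΛ, hΓ]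
    exact fun G h ↦ ⟨ht h.1, h.2⟩) ⟨F₀, hΛ ▸ ⟨hF₀, .refl⟩⟩
  rw [hΛ] at hF hleaf
  -- Facets outside the component of `F₀` miss `F`, so a leaf inside the component is a leaf of all
  -- of `t`; if it is alone there, any other member of `t` serves as joint.
  have hdisj : ∀ H ∈ t, ¬ Δ.Linked F₀ H → F ∩ H = ∅ := fun H hH hn ↦ by
    by_contra hne
    exact hn (hF.2.tail ⟨ht hF.1, ht hH, fun h ↦ hne (Finset.disjoint_iff_inter_eq_empty.1 h)⟩)
  refine ⟨F, hF.1, ?_⟩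
  rcases hleaf with hsingle | ⟨G, hG, hGF, hjoint⟩
  · by_cases hex : ∃ G ∈ t, G ≠ F
    · obtain ⟨G, hG, hGF⟩ := hex
      refine .inr ⟨G, hG, hGF, fun H hH hHF ↦ ?_⟩
      rw [hdisj H hH fun hl ↦ hHF ?_]
      · exact Finset.empty_subset _
      · have : H ∈ {G | G ∈ t ∧ Δ.Linked F₀ G} := ⟨hH, hl⟩
        rwa [hsingle] at this
    · push Not at hex
      exact .inl (Finset.eq_singleton_iff_unique_mem.2 ⟨hF.1, hex⟩)
  · refine .inr ⟨G, hG.1, hGF, fun H hH hHF ↦ ?_⟩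
    by_cases hl : Δ.Linked F₀ H
    · exact_mod_cast hjoint H ⟨hH, hl⟩ hHF
    · rw [hdisj H hH hl]
      exact Finset.empty_subset _

section Fintype

variable [Fintype V]

theorem bddAbove_card_matching (Δ : PreAbstractSimplicialComplex V) :
    BddAbove {n | ∃ M : Finset (Finset V), Δ.IsMatching M ∧ M.card = n} := by
  refine ⟨Fintype.card (Finset V), ?_⟩
  rintro _ ⟨M, -, rfl⟩
  exact M.card_le_univ

theorem IsMatching.card_le {Δ : PreAbstractSimplicialComplex V} {M : Finset (Finset V)}
    (hM : Δ.IsMatching M) : M.card ≤ Δ.matchingNumber :=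
  le_csSup Δ.bddAbove_card_matching ⟨M, hM, rfl⟩

theorem exists_isMatching_card_eq (Δ : PreAbstractSimplicialComplex V) :
    ∃ M : Finset (Finset V), Δ.IsMatching M ∧ M.card = Δ.matchingNumber :=
  Nat.sSup_mem (s := {n | ∃ M : Finset (Finset V), Δ.IsMatching M ∧ M.card = n})
    ⟨0, ∅, ⟨by simp, by simp⟩, rfl⟩ Δ.bddAbove_card_matching

/-- A simplicial forest has a vertex cover of size at most its matching number. -/
theorem IsSimplicialForest.exists_vertexCover [DecidableEq V]
    {Δ : PreAbstractSimplicialComplex V} (hΔ : Δ.IsSimplicialForest) :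
    ∃ C : Finset V, C.card ≤ Δ.matchingNumber ∧ ∀ F ∈ Δ.facets, (F ∩ C).Nonempty := by
  obtain ⟨m, hm, hmd, C, hC, hcov⟩ := exists_matching_transversal_of_leaf
    (Set.toFinite Δ.facets).toFinset id
    (fun F hF ↦ nonempty_of_mem_facets (by simpa using hF))
    (fun t ht htn ↦ hΔ.exists_leaf t (fun F hF ↦ by simpa using ht hF) htn)
  have hM : Δ.IsMatching m := ⟨fun F hF ↦ by simpa using hm hF, hmd⟩
  exact ⟨C, hC.trans hM.card_le, fun F hF ↦ hcov F (by simpa using hF)⟩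

end Fintype

end PreAbstractSimplicialComplex

/-! ### Ideals generated by variables -/

namespace MvPolynomial

variable {V : Type*} {K : Type*} [Field K]

/-- An ideal generated by variables is prime. -/
theorem isPrime_span_X_image (W : Set V) :
    (Ideal.span (X '' W : Set (MvPolynomial V K))).IsPrime := by
  classical
  set I := Ideal.span (X '' W : Set (MvPolynomial V K))
  -- Setting the variables in `W` to zero is the identity modulo `I`, so its kernel is `I`, and its
  -- target is a domain.
  let φ : MvPolynomial V K →ₐ[K] MvPolynomial V K := aeval fun v ↦ if v ∈ W then 0 else X v
  have hcomp : (Ideal.Quotient.mkₐ K I).comp φ = Ideal.Quotient.mkₐ K I := by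
    refine algHom_ext fun v ↦ ?_
    by_cases hv : v ∈ W
    · simpa [φ, hv] using
        (Ideal.Quotient.eq_zero_iff_mem.2 (Ideal.subset_span ⟨v, hv, rfl⟩ : X v ∈ I)).symm
    · simp [φ, hv]
  have hker : I = RingHom.ker φ := by
    refine le_antisymm (Ideal.span_le.2 ?_) fun p hp ↦ ?_
    · rintro _ ⟨v, hv, rfl⟩
      simp [φ, hv]
    · have := DFunLike.congr_fun hcomp p
      rw [AlgHom.comp_apply, (RingHom.mem_ker).1 hp, map_zero] at this
      exact Ideal.Quotient.eq_zero_iff_mem.1 this.symm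
  rw [hker]
  exact RingHom.ker_isPrime _

theorem X_mem_span_X_image_iff {W : Set V} {v : V} :
    (X v : MvPolynomial V K) ∈ Ideal.span (X '' W : Set (MvPolynomial V K)) ↔ v ∈ W := by
  classical
  refine ⟨fun h ↦ ?_, fun h ↦ Ideal.subset_span ⟨v, h, rfl⟩⟩
  obtain ⟨i, hi, hne⟩ := mem_ideal_span_X_image.1 h (Finsupp.single v 1) (by simp)
  have : i = v := by
    by_contra hiv
    exact hne (Finsupp.single_eq_of_ne hiv)
  exact this ▸ hi

theorem card_le_height_span_X_image [Finite V] (W : Finset V) :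
    (W.card : ℕ∞) ≤ (Ideal.span (X '' (W : Set V) : Set (MvPolynomial V K))).height := by
  classical
  induction W using Finset.induction_on with
  | empty => simp
  | insert v W hv ih =>
    have := isPrime_span_X_image (K := K) (W : Set V)
    have := isPrime_span_X_image (K := K) ((insert v W : Finset V) : Set V)
    rw [Finset.card_insert_of_notMem hv]
    rw [Nat.cast_add_one]
    refine (add_le_add_left ih 1).trans (Ideal.height_add_one_le_of_lt_of_isPrime
      (lt_of_le_of_ne (Ideal.span_mono (Set.image_mono (by simp))) fun heq ↦ hv ?_))
    have hmem : (X v : MvPolynomial V K) ∈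
        Ideal.span (X '' ((insert v W : Finset V) : Set V)) :=
      Ideal.subset_span ⟨v, by simp, rfl⟩
    rw [← heq, X_mem_span_X_image_iff] at hmem
    exact hmem

theorem height_span_X_image_le [Finite V] (W : Finset V) :
    (Ideal.span (X '' (W : Set V) : Set (MvPolynomial V K))).height ≤ W.card := by
  refine (Ideal.height_le_spanFinrank _ (isPrime_span_X_image _).ne_top).trans ?_
  refine (Submodule.spanFinrank_span_le_encard _).trans ((Set.encard_image_le _ _).trans ?_)
  simp

/-- The ideal of all variables has height at least `|V|`, and killing `|W|` elements of it lowers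
its height by at most `|W|`. -/
theorem card_le_ringKrullDim_quotient_span_X_image_add [Fintype V] (W : Finset V) :
    (Fintype.card V : WithBot ℕ∞) ≤
      ringKrullDim (MvPolynomial V K ⧸ Ideal.span (X '' (W : Set V) : Set (MvPolynomial V K))) +
        (W.card : ℕ) := by
  have := isPrime_span_X_image (K := K) ((Finset.univ : Finset V) : Set V)
  have h := Ideal.height_le_ringKrullDim_quotient_add_encard
    (p := Ideal.span (X '' ((Finset.univ : Finset V) : Set V) : Set (MvPolynomial V K)))
    (X '' (W : Set V)) ((Set.image_mono (by simp)).trans Ideal.subset_span)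
  have h' := card_le_height_span_X_image (K := K) (Finset.univ : Finset V)
  rw [Set.InjOn.encard_image (X_injective.injOn), Set.encard_coe_eq_coe_finsetCard] at h
  refine le_trans ?_ h
  exact_mod_cast h'

/-- A square-free monomial lying in the `k`-th power of an ideal generated by the variables in `C`
involves at least `k` variables of `C`. -/
theorem le_card_inter_of_prod_X_mem_pow [DecidableEq V] {C S : Finset V} {k : ℕ}
    (h : (∏ v ∈ S, X v : MvPolynomial V K) ∈
      Ideal.span (X '' (C : Set V) : Set (MvPolynomial V K)) ^ k) : k ≤ (S ∩ C).card := by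
  -- This substitution turns a monomial's degree in the variables of `C` into a power of a single
  -- variable.
  let φ : MvPolynomial V K →ₐ[K] Polynomial K := aeval fun v ↦ if v ∈ C then Polynomial.X else 1
  have hle : (Ideal.span (X '' (C : Set V) : Set (MvPolynomial V K))).map φ ≤
      Ideal.span {Polynomial.X} := by
    rw [Ideal.map_span, Ideal.span_le]
    rintro _ ⟨_, ⟨v, hv, rfl⟩, rfl⟩
    have hv' : v ∈ C := hv
    simp [φ, hv']
  have hmem := Ideal.pow_right_mono hle k (Ideal.map_pow φ _ k ▸ Ideal.mem_map_of_mem φ h)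
  have hφ : φ (∏ v ∈ S, X v) = Polynomial.X ^ (S ∩ C).card := by
    simp only [φ, map_prod, aeval_X]
    rw [Finset.prod_ite_mem, Finset.prod_const]
  rw [hφ, Ideal.span_singleton_pow, Ideal.mem_span_singleton] at hmem
  exact (pow_dvd_pow_iff Polynomial.X_ne_zero Polynomial.not_isUnit_X).1 hmem

end MvPolynomial

/-- A chain of primes over `I` starts at a prime of height at least that of `I`, so it can be
prolonged downwards by that much. -/
theorem Ideal.ringKrullDim_quotient_add_height_le {R : Type*} [CommRing R] (I : Ideal R)
    (hI : I ≠ ⊤) : ringKrullDim (R ⧸ I) + (I.height : WithBot ℕ∞) ≤ ringKrullDim R := by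
  have : Nontrivial (R ⧸ I) := Ideal.Quotient.nontrivial_iff.2 hI
  have : Nontrivial R := (Ideal.Quotient.mk I).domain_nontrivial
  have : Nonempty (PrimeSpectrum.zeroLocus (R := R) I) :=
    (inferInstance : Nonempty (PrimeSpectrum (R ⧸ I))).map
      I.primeSpectrumQuotientOrderIsoZeroLocus
  rw [ringKrullDim_quotient, Order.krullDim_eq_iSup_length, ringKrullDim,
    Order.krullDim_eq_iSup_height_add_coheight_of_nonempty, ← WithBot.coe_add,
    WithBot.coe_le_coe, ENat.iSup_add]
  refine iSup_le fun p ↦ ?_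
  let q : LTSeries (PrimeSpectrum R) := p.map Subtype.val fun _ _ h ↦ h
  refine le_trans ?_ (le_iSup _ q.head)
  rw [add_comm]
  refine add_le_add ?_ (Order.length_le_coheight_head (p := q))
  rw [← PrimeSpectrum.height_eq_orderHeight]
  exact Ideal.height_mono p.head.2

/-! ### Bounds for square-free powers -/

section SquareFreePower

open MvPolynomial

variable {V : Type*} {K : Type*} [Field K] {Δ : PreAbstractSimplicialComplex V}

/-- The square-free power of a facet ideal is contained in the ideal generated by all but `k - 1`
vertices of a vertex cover. -/
theorem squareFreePower_facetIdeal_le [DecidableEq V] {C D : Finset V} {k : ℕ}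
    (hcov : ∀ F ∈ Δ.facets, (F ∩ C).Nonempty) (hD : D.card < k) :
    squareFreePower (Δ.facetIdeal K) k ≤
      Ideal.span (X '' ((C \ D : Finset V) : Set V) : Set (MvPolynomial V K)) := by
  have hI : Δ.facetIdeal K ≤ Ideal.span (X '' (C : Set V) : Set (MvPolynomial V K)) := by
    refine Ideal.span_le.2 ?_
    rintro _ ⟨F, hF, rfl⟩
    obtain ⟨v, hv⟩ := hcov F hF
    rw [Finset.mem_inter] at hv
    exact Ideal.mem_of_dvd _ (Finset.dvd_prod_of_mem _ hv.1) (Ideal.subset_span ⟨v, hv.2, rfl⟩)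
  refine Ideal.span_le.2 ?_
  rintro _ ⟨hf, S, rfl⟩
  have hcard := le_card_inter_of_prod_X_mem_pow (Ideal.pow_right_mono hI k hf)
  obtain ⟨v, hv, hvD⟩ := Finset.exists_mem_notMem_of_card_lt_card (hD.trans_le hcard)
  rw [Finset.mem_inter] at hv
  exact Ideal.mem_of_dvd _ (Finset.dvd_prod_of_mem _ hv.1)
    (Ideal.subset_span ⟨v, by simp [hv.2, hvD], rfl⟩)

theorem prod_biUnion_mem_squareFreePower [DecidableEq V] {M : Finset (Finset V)}
    (hM : Δ.IsMatching M) :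
    (∏ v ∈ M.biUnion id, X v : MvPolynomial V K) ∈
      squareFreePower (Δ.facetIdeal K) M.card := by
  refine Ideal.subset_span ⟨?_, _, rfl⟩
  rw [Finset.prod_biUnion hM.2, ← Finset.prod_const]
  exact Ideal.prod_mem_prod fun F hF ↦ Ideal.subset_span ⟨F, hM.1 hF, rfl⟩

/-- Every prime ideal containing the `k`-th square-free power of the facet ideal has height at
least `ν(Δ) - k + 1`. -/
theorem matchingNumber_le_height_squareFreePower [Fintype V] (k : ℕ) :
    ((Δ.matchingNumber + 1 - k : ℕ) : ℕ∞) ≤ (squareFreePower (Δ.facetIdeal K) k).height := by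
  classical
  obtain ⟨M, hM, hMc⟩ := Δ.exists_isMatching_card_eq
  rw [Ideal.height_eq_inf_minimalPrimes]
  refine le_iInf₂ fun P hP ↦ ?_
  have hPp := hP.isPrime
  let W : Finset V := {v | (X v : MvPolynomial V K) ∈ P}
  have hWP : Ideal.span (X '' (W : Set V)) ≤ P := by
    refine Ideal.span_le.2 ?_
    rintro _ ⟨v, hv, rfl⟩
    simpa [W] using hv
  refine le_trans ?_ ((card_le_height_span_X_image W).trans (Ideal.height_mono hWP))
  rw [Nat.cast_le]
  have hmiss : (M.filter fun F ↦ Disjoint F W).card < k := by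
    by_contra! hge
    obtain ⟨N, hN, hNc⟩ := Finset.exists_subset_card_eq hge
    have hNM : N ⊆ M := hN.trans (Finset.filter_subset _ _)
    have hmem : (∏ v ∈ N.biUnion id, X v : MvPolynomial V K) ∈ P :=
      hP.le (hNc ▸ prod_biUnion_mem_squareFreePower
        ⟨fun F hF ↦ hM.1 (hNM hF), hM.2.subset (by exact_mod_cast hNM)⟩)
    obtain ⟨v, hv, hvP⟩ := hPp.prod_mem_iff.1 hmem
    obtain ⟨F, hF, hvF⟩ := Finset.mem_biUnion.1 hv
    exact Finset.disjoint_left.1 (Finset.mem_filter.1 (hN hF)).2 hvF (by simpa [W] using hvP)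
  -- Disjoint facets meet `W` in distinct vertices.
  have hhit : (M.filter fun F ↦ ¬ Disjoint F W).card ≤ W.card := by
    refine Finset.card_le_card_of_forall_subsingleton (fun F v ↦ v ∈ F) (fun F hF ↦ ?_)
      fun v hv F hF G hG ↦ ?_
    · obtain ⟨v, hvF, hvW⟩ := Finset.not_disjoint_iff.1 (Finset.mem_filter.1 hF).2
      exact ⟨v, hvW, hvF⟩
    · exact hM.2.elim (Finset.mem_filter.1 hF.1).1 (Finset.mem_filter.1 hG.1).1
        (Finset.not_disjoint_iff.2 ⟨v, hF.2, hG.2⟩)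
  have := Finset.card_filter_add_card_filter_not (s := M) (fun F ↦ Disjoint F W)
  lia

end SquareFreePower

theorem theorem3p5 {V : Type*} [Fintype V] {K : Type*} [Field K]
    (Δ : PreAbstractSimplicialComplex V) (hΔ : Δ.IsCohenMacaulayForest K)
    (k : ℕ) (hk : 1 ≤ k) (hkν : k ≤ Δ.matchingNumber) :
    (∃ d : ℕ, ringKrullDim (MvPolynomial V K ⧸ squareFreePower (Δ.facetIdeal K) k) = d ∧
      (d : ℤ) = Fintype.card V - Δ.matchingNumber + k - 1) ∧
    (∃ h : ℕ, (squareFreePower (Δ.facetIdeal K) k).height = h ∧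
      (h : ℤ) = Δ.matchingNumber - k + 1) := by
  classical
  obtain ⟨C, hC, hcov⟩ := hΔ.1.exists_vertexCover
  -- The minimum avoids having to compare `|C|` with `k - 1`; either way `C \ D` is small enough.
  obtain ⟨D, hDC, hD⟩ := Finset.exists_subset_card_eq (Nat.min_le_right (k - 1) C.card)
  set J := squareFreePower (Δ.facetIdeal K) k
  have hJ := squareFreePower_facetIdeal_le (K := K) hcov (show D.card < k by lia)
  have hcard : (C \ D).card ≤ Δ.matchingNumber + 1 - k := by
    rw [Finset.card_sdiff_of_subset hDC]
    lia
  have hheight : J.height = (Δ.matchingNumber + 1 - k : ℕ) :=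
    le_antisymm ((Ideal.height_mono hJ).trans ((MvPolynomial.height_span_X_image_le _).trans
      (by exact_mod_cast hcard))) (matchingNumber_le_height_squareFreePower k)
  have hupper := J.ringKrullDim_quotient_add_height_le
    (ne_top_of_le_ne_top (MvPolynomial.isPrime_span_X_image _).ne_top hJ)
  rw [hheight, MvPolynomial.ringKrullDim_of_isNoetherianRing, ringKrullDim_eq_zero_of_field,
    zero_add, Nat.card_eq_fintype_card] at hupper
  have hlower := (MvPolynomial.card_le_ringKrullDim_quotient_span_X_image_add (K := K)
    (C \ D)).trans (add_le_add (ringKrullDim_le_of_surjective (Ideal.Quotient.factor hJ)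
      (Ideal.Quotient.factor_surjective hJ)) (Nat.cast_le.2 hcard))
  have hdim : ∃ d : ℕ, ringKrullDim (MvPolynomial V K ⧸ J) = d ∧
      d + (Δ.matchingNumber + 1 - k) = Fintype.card V := by
    -- The lower bound excludes `⊥` and the upper bound excludes `⊤`, leaving a natural number.
    generalize ringKrullDim (MvPolynomial V K ⧸ J) = e at hupper hlower
    induction e with
    | bot => simp at hlower
    | coe e =>
      induction e using ENat.recTopCoe with
      | top =>
        change ((⊤ + (Δ.matchingNumber + 1 - k : ℕ) : ℕ∞) : WithBot ℕ∞) ≤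
          ((Fintype.card V : ℕ∞) : WithBot ℕ∞) at hupper
        rw [WithBot.coe_le_coe, top_add, top_le_iff] at hupper
        exact absurd hupper (ENat.natCast_ne_top _)
      | coe e =>
        change ((e + (Δ.matchingNumber + 1 - k : ℕ) : ℕ∞) : WithBot ℕ∞) ≤
          ((Fintype.card V : ℕ∞) : WithBot ℕ∞) at hupper
        change ((Fintype.card V : ℕ∞) : WithBot ℕ∞) ≤
          ((e + (Δ.matchingNumber + 1 - k : ℕ) : ℕ∞) : WithBot ℕ∞) at hlower
        rw [WithBot.coe_le_coe] at hupper hlower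
        exact ⟨e, rfl, le_antisymm (by exact_mod_cast hupper) (by exact_mod_cast hlower)⟩
  obtain ⟨d, hd, hd'⟩ := hdim
  exact ⟨⟨d, hd, by lia⟩, _, hheight, by lia⟩
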